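/- Let $(F_m)_{m\ge 0}$ be the Fibonacci sequence, $F_0=0$, $F_1=1$, $F_{m+1}=F_m+F_{m-1}$. Let $n>1$ be an integer with $n\equiv 1\pmod 4$ and $n\notin\{9,25\}$. Then $$\sum_{k=1}^{n-1}\frac{F_{kn}}{F_k}\equiv 0\pmod{F_n}$$ holds if and only if $n$ is prime. (Each quotient $F_{kn}/F_k$ is an integer, since $F_k\mid F_{kn}$.) -/

import Mathlib

/-- The quotient `F (k * n) / F k` of natural numbers is exact: multiplying it by `F k`
gives back `F (k * n)`. So natural-number division is the true quotient here. -/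
theorem fib_mul_div_mul_cancel (k n : ℕ) :
    Nat.fib (k * n) / Nat.fib k * Nat.fib k = Nat.fib (k * n) :=
  Nat.div_mul_cancel (Nat.fib_dvd k (k * n) (Dvd.intro n rfl))

/-! For prime `n`, `F n` is coprime to each `F k` with `k < n`, so it divides every quotient. For
composite `n = p * m`, with `p` the least prime factor, take a prime `q` of rank exactly `m` (`q ∣ F
k` iff `m ∣ k`). Modulo `q` the terms with `m ∤ k` vanish and the other `p - 1` terms are `n`, so `q
∣ (p - 1) * n` and hence `q ≤ m`. But `m` is odd and divides `q - 1` or `q + 1`, which makes `m < q`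
unless `q = 2`; that case gives `n = 9`. Such a `q` exists for odd `m > 1`, `m ≠ 5`
(`exists_primitive_prime`). For composite `m`, let `N` be the absolute norm of `Φ_m(-ω²)` in `ℤ[ω]`,
where `-ω²` is the ratio of the roots of `x² = x + 1`. Without a `q`, `N` is a power of one prime `p
∣ m`. Size gives `N > p ^ 2`, while `N` divides the square of `F m / F (m / p)`, which `p ^ 2` does
not divide: a contradiction. -/

/-! ### Fibonacci quotients modulo `F k` and modulo `p ^ 2`. -/

open Finset in
/-- `F (k * n)` is `F k` times a quotient that is a geometric sum in `F (k - 1)` and `F (k + 1)`,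
modulo the square of `F k`. -/
theorem exists_fib_mul_eq (k n : ℕ) :
    ∃ Q : ℤ, (Nat.fib ((k + 1) * n) : ℤ) = Nat.fib (k + 1) * Q ∧
      (Nat.fib (k + 1) : ℤ) ^ 2 ∣
        Q - ∑ i ∈ range n, ((Nat.fib k : ℤ) + Nat.fib (k + 1)) ^ i * (Nat.fib k : ℤ) ^ (n - 1 - i) ∧
      (Nat.fib (k + 1) : ℤ) ^ 2 ∣
        Nat.fib ((k + 1) * n + 1) - ((Nat.fib k : ℤ) + Nat.fib (k + 1)) ^ n := by
  induction n with
  | zero => exact ⟨0, by simp⟩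
  | succ n ih =>
    obtain ⟨Q, h1, ⟨s, h2⟩, ⟨t, h3⟩⟩ := ih
    set c : ℤ := (Nat.fib k : ℤ)
    set F : ℤ := (Nat.fib (k + 1) : ℤ)
    have e1 : (Nat.fib ((k + 1) * (n + 1)) : ℤ)
        = Nat.fib ((k + 1) * n) * c + Nat.fib ((k + 1) * n + 1) * F := by
      have := Nat.fib_add ((k + 1) * n) k
      rw [show (k + 1) * (n + 1) = (k + 1) * n + k + 1 by ring, this]
      push_cast; rfl
    have e2 : (Nat.fib ((k + 1) * (n + 1) + 1) : ℤ)
        = Nat.fib ((k + 1) * n) * F + Nat.fib ((k + 1) * n + 1) * (c + F) := by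
      have := Nat.fib_add ((k + 1) * n) (k + 1)
      rw [show (k + 1) * (n + 1) + 1 = (k + 1) * n + (k + 1) + 1 by ring, this, Nat.fib_add_two]
      push_cast; rfl
    have e3 : ∑ i ∈ range (n + 1), (c + F) ^ i * c ^ (n + 1 - 1 - i)
        = (∑ i ∈ range n, (c + F) ^ i * c ^ (n - 1 - i)) * c + (c + F) ^ n := by
      rw [sum_range_succ, sum_mul]
      congr 1
      · refine sum_congr rfl fun i hi => ?_
        rw [mem_range] at hi
        rw [show n + 1 - 1 - i = n - 1 - i + 1 by omega, pow_succ, mul_assoc]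
      · simp
    refine ⟨Q * c + Nat.fib ((k + 1) * n + 1), ?_, ⟨s * c + t, ?_⟩, ⟨Q + t * (c + F), ?_⟩⟩
    · rw [e1, h1]; ring
    · rw [e3]; linear_combination c * h2 + h3
    · rw [e2, h1, pow_succ (c + F)]; linear_combination (c + F) * h3

/-- Modulo `F k`, the quotient `F (k * n) / F k` is `n * F (k - 1) ^ (n - 1)`. -/
theorem fib_mul_div_modEq (k n : ℕ) :
    ((Nat.fib ((k + 1) * n) / Nat.fib (k + 1) : ℕ) : ℤ) ≡ n * (Nat.fib k : ℤ) ^ (n - 1)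
      [ZMOD Nat.fib (k + 1)] := by
  obtain ⟨Q, h1, h2, -⟩ := exists_fib_mul_eq k n
  have hpos : (0 : ℤ) < Nat.fib (k + 1) := by exact_mod_cast Nat.fib_pos.2 k.succ_pos
  have hQ : ((Nat.fib ((k + 1) * n) / Nat.fib (k + 1) : ℕ) : ℤ) = Q := by
    push_cast
    rw [h1, Int.mul_ediv_cancel_left _ hpos.ne']
  rw [hQ]
  have h3 : Q ≡ _ [ZMOD Nat.fib (k + 1)] :=
    (Int.modEq_iff_dvd.2 ((dvd_pow_self _ two_ne_zero).trans h2)).symm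
  refine h3.trans ?_
  have : ∀ i ∈ Finset.range n, ((Nat.fib k : ℤ) + Nat.fib (k + 1)) ^ i * (Nat.fib k : ℤ) ^ (n - 1 - i)
      ≡ (Nat.fib k : ℤ) ^ (n - 1) [ZMOD Nat.fib (k + 1)] := by
    intro i hi
    rw [Finset.mem_range] at hi
    have h : (Nat.fib k : ℤ) + Nat.fib (k + 1) ≡ Nat.fib k [ZMOD Nat.fib (k + 1)] := by
      simp [Int.ModEq]
    have := (h.pow i).mul_right ((Nat.fib k : ℤ) ^ (n - 1 - i))
    rwa [← pow_add, show i + (n - 1 - i) = n - 1 by omega] at this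
  have := Int.ModEq.sum this
  simpa using this

/-- Cassini's identity modulo `F (k + 1)`. -/
theorem fib_sq_modEq (k : ℕ) :
    (Nat.fib k : ℤ) ^ 2 ≡ (-1) ^ (k + 1) [ZMOD Nat.fib (k + 1)] := by
  have h : (Nat.fib k : ℤ) ^ 2 + Nat.fib k * Nat.fib (k + 1) - (Nat.fib (k + 1) : ℤ) ^ 2
      = (-1) ^ (k + 1) := by
    induction k with
    | zero => simp
    | succ k ih =>
      rw [Nat.fib_add_two, pow_succ (-1 : ℤ), ← ih]
      push_cast; ring
  refine Int.modEq_iff_dvd.2 ⟨Nat.fib k - Nat.fib (k + 1), ?_⟩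
  rw [← h]; ring

/-- By Cassini the square of `F (k - 1)` is `±1`, so its power with exponent `n - 1`, a multiple of
4, is 1. -/
theorem fib_mul_div_modEq_of_modEq_one {n : ℕ} (hn : n ≡ 1 [MOD 4]) {k : ℕ} (hk : 0 < k) :
    Nat.fib (k * n) / Nat.fib k ≡ n [MOD Nat.fib k] := by
  obtain ⟨k, rfl⟩ := Nat.exists_eq_add_of_lt hk
  rw [zero_add]
  refine (Int.natCast_modEq_iff).1 ((fib_mul_div_modEq k n).trans ?_)
  have h4 : n % 4 = 1 := hn
  obtain ⟨j, hj⟩ : ∃ j, n - 1 = 2 * (2 * j) := ⟨n / 4, by omega⟩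
  rw [hj, pow_mul]
  have := (((fib_sq_modEq k).pow (2 * j)).mul_left (n : ℤ))
  rwa [← pow_mul (-1 : ℤ), show (k + 1) * (2 * j) = 2 * ((k + 1) * j) by ring,
    pow_mul (-1 : ℤ), neg_one_sq, one_pow, mul_one] at this

/-- If an odd prime `p` divides `F a` then `p ^ 2` does not divide `F (a * p) / F a`. -/
theorem not_sq_dvd_of_fib_mul_eq {p a Q : ℕ} (hp : p.Prime) (hodd : Odd p) (ha : 0 < a)
    (hpa : p ∣ Nat.fib a) (hQ : Nat.fib (a * p) = Nat.fib a * Q) : ¬ p ^ 2 ∣ Q := by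
  intro hdvd
  obtain ⟨k, rfl⟩ := Nat.exists_eq_add_of_lt ha
  rw [zero_add] at *
  obtain ⟨Q', h1, h2, -⟩ := exists_fib_mul_eq k p
  have hpos : (0 : ℤ) < Nat.fib (k + 1) := by exact_mod_cast Nat.fib_pos.2 k.succ_pos
  have hQQ : (Q : ℤ) = Q' := by
    rw [hQ] at h1
    push_cast at h1
    exact mul_left_cancel₀ hpos.ne' h1
  obtain ⟨t, ht⟩ := hpa
  -- For odd `p`, the geometric sum in `x` and `x + p * t` is `p * x ^ (p - 1)` modulo `p ^ 2`.
  have h3 := odd_sq_dvd_geom_sum₂_sub (R := ℤ) (Nat.fib k : ℤ) (t : ℤ) hodd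
  have hF : (Nat.fib (k + 1) : ℤ) = p * t := by exact_mod_cast ht
  rw [hF] at h2
  have h4 : (p : ℤ) ^ 2 ∣ Q' - _ := (pow_dvd_pow_of_dvd (dvd_mul_right (p : ℤ) t) 2).trans h2
  have h5 : (p : ℤ) ^ 2 ∣ Q' := by rw [← hQQ]; exact_mod_cast hdvd
  have h6 : (p : ℤ) ^ 2 ∣ p * (Nat.fib k : ℤ) ^ (p - 1) := by
    have h6 := dvd_sub h5 (dvd_add h4 h3)
    rwa [sub_add_sub_cancel, sub_sub_cancel] at h6
  have h7 : (p : ℤ) ∣ (Nat.fib k : ℤ) ^ (p - 1) := by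
    rw [pow_two] at h6
    exact Int.dvd_of_mul_dvd_mul_left (by exact_mod_cast hp.ne_zero) h6
  have h8 : p ∣ Nat.fib k := by
    have := (Nat.prime_iff_prime_int.1 hp).dvd_of_dvd_pow h7
    exact_mod_cast this
  have h9 := Nat.dvd_gcd h8 (Dvd.intro t ht.symm)
  rw [(Nat.fib_coprime_fib_succ k).gcd_eq_one] at h9
  exact hp.one_lt.ne' (Nat.dvd_one.1 h9)

/-! ### Binet's formula and the order of `-α ^ 2`. -/

theorem fib_mul_two_mul_sub_one {R : Type*} [CommRing R] {α : R} (h : α ^ 2 = α + 1) (k : ℕ) :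
    (Nat.fib k : R) * (2 * α - 1) = α ^ k - (1 - α) ^ k := by
  have key : ∀ β : R, β ^ 2 = β + 1 → ∀ k : ℕ, β ^ (k + 1) = Nat.fib (k + 1) * β + Nat.fib k := by
    intro β hβ k
    induction k with
    | zero => simp
    | succ k ih =>
      rw [pow_succ, ih, Nat.fib_add_two]
      push_cast
      linear_combination (Nat.fib (k + 1) : R) * hβ
  cases k with
  | zero => simp
  | succ k =>
    rw [key α h, key (1 - α) (by linear_combination h)]
    ring

section Field

variable {K : Type*} [Field K] {α : K}

/-- Since `α * (1 - α) = -1`, `-α ^ 2` is the ratio `α / (1 - α)`; Binet's formula applies because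
`2 * α - 1`, a square root of 5, is nonzero. -/
theorem neg_sq_pow_eq_one_iff (h : α ^ 2 = α + 1) (h5 : (5 : K) ≠ 0) (k : ℕ) :
    (-α ^ 2) ^ k = 1 ↔ (Nat.fib k : K) = 0 := by
  have h1 : 2 * α - 1 ≠ 0 := by
    intro h0
    apply h5
    linear_combination (2 * α - 1) * h0 - 4 * h
  have h2 : α * (1 - α) = -1 := by linear_combination -h
  have h3 : 1 - α ≠ 0 := by
    intro h0
    simp [h0] at h2
  have h4 : (-α ^ 2) * (1 - α) = α := by linear_combination -α * h2
  have h6 : (-α ^ 2) ^ k * (1 - α) ^ k = α ^ k := by rw [← mul_pow, h4]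
  have h7 := fib_mul_two_mul_sub_one h k
  constructor
  · intro e
    rw [e, one_mul] at h6
    rw [h6, sub_self] at h7
    exact (mul_eq_zero.1 h7).resolve_right h1
  · intro e
    rw [e, zero_mul, eq_comm, sub_eq_zero] at h7
    rw [h7] at h6
    exact mul_right_cancel₀ (pow_ne_zero k h3) (by rw [h6, one_mul])

theorem neg_sq_eq_one_of_five_eq_zero (h : α ^ 2 = α + 1) (h5 : (5 : K) = 0) : -α ^ 2 = 1 := by
  have h1 : (2 * α - 1) ^ 2 = 0 := by linear_combination 4 * h + h5
  have h2 : 2 * α - 1 = 0 := pow_eq_zero_iff two_ne_zero |>.1 h1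
  linear_combination -h + 2 * h2 - α * h5

/-- Frobenius either fixes `α` or swaps it with its conjugate `1 - α`. -/
theorem neg_sq_pow_sub_one_or_add_one {p : ℕ} [hp : Fact p.Prime] [CharP K p]
    (h : α ^ 2 = α + 1) : (-α ^ 2) ^ (p - 1) = 1 ∨ (-α ^ 2) ^ (p + 1) = 1 := by
  have h1 : frobenius K p α ^ 2 = frobenius K p α + 1 := by
    rw [← map_pow, h, map_add, map_one]
  have h2 : α * (1 - α) = -1 := by linear_combination -h
  have h0 : -α ^ 2 ≠ 0 := by
    have : α ≠ 0 := by rintro rfl; simp at h2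
    simpa using this
  have h3 : (-α ^ 2) ^ p = -(frobenius K p α) ^ 2 := by
    rw [← map_pow, ← map_neg, frobenius_def]
  have h4 : (frobenius K p α - α) * (frobenius K p α - (1 - α)) = 0 := by
    linear_combination h1 - h
  rcases mul_eq_zero.1 h4 with h5 | h5
  · left
    rw [sub_eq_zero.1 h5] at h3
    apply mul_right_cancel₀ h0
    rw [← pow_succ, Nat.sub_add_cancel hp.out.one_le, h3, one_mul]
  · right
    rw [sub_eq_zero.1 h5] at h3
    rw [pow_succ, h3]
    linear_combination (α * (1 - α) - 1) * h2

end Field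

/-! ### Size of cyclotomic values. -/

open Polynomial

theorem norm_eval_cyclotomic_bounds (m : ℕ) (hm : m ≠ 0) (z : ℂ) :
    |‖z‖ - 1| ^ m.totient ≤ ‖(cyclotomic m ℂ).eval z‖ ∧
      ‖(cyclotomic m ℂ).eval z‖ ≤ (‖z‖ + 1) ^ m.totient := by
  have hζ := Complex.isPrimitiveRoot_exp m hm
  have hcard := hζ.card_primitiveRoots
  have hnorm : ∀ ζ ∈ primitiveRoots m ℂ, ‖ζ‖ = 1 := fun ζ h =>
    ((mem_primitiveRoots (Nat.pos_of_ne_zero hm)).1 h).norm'_eq_one hm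
  rw [cyclotomic_eq_prod_X_sub_primitiveRoots hζ, eval_prod, norm_prod, ← hcard,
    ← Finset.prod_const, ← Finset.prod_const]
  constructor
  · refine Finset.prod_le_prod (fun _ _ => abs_nonneg _) fun ζ h => ?_
    have := abs_norm_sub_norm_le z ζ
    simpa [hnorm ζ h] using this
  · refine Finset.prod_le_prod (fun _ _ => norm_nonneg _) fun ζ h => ?_
    have := norm_sub_le z ζ
    simpa [hnorm ζ h] using this

theorem goldenRatio_sq_gt : (2.6 : ℝ) < Real.goldenRatio ^ 2 := by
  rw [Real.goldenRatio_sq, Real.goldenRatio]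
  have : (2.22 : ℝ) < √5 := by
    rw [Real.lt_sqrt] <;> norm_num
  linarith

theorem lt_goldenRatio_pow {q : ℕ} (hq : 3 ≤ q) :
    (q : ℝ) + 2 < Real.goldenRatio ^ (2 * q) := by
  rw [pow_mul]
  refine lt_of_lt_of_le ?_ (pow_le_pow_left₀ (by norm_num) goldenRatio_sq_gt.le q)
  induction q, hq using Nat.le_induction with
  | base => norm_num
  | succ q hq ih =>
    rw [pow_succ]; push_cast
    have : (3 : ℝ) ≤ q := by exact_mod_cast hq
    linarith

theorem five_mul_lt_goldenRatio_pow {q : ℕ} (hq : 5 ≤ q) :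
    5 * (q : ℝ) + 2 < Real.goldenRatio ^ (2 * q) := by
  rw [pow_mul]
  refine lt_of_lt_of_le ?_ (pow_le_pow_left₀ (by norm_num) goldenRatio_sq_gt.le q)
  induction q, hq using Nat.le_induction with
  | base => norm_num
  | succ q hq ih =>
    rw [pow_succ]; push_cast
    have : (5 : ℝ) ≤ q := by exact_mod_cast hq
    linarith

/-- Lower bound for a product of two conjugate cyclotomic values. -/
theorem lt_norm_eval_cyclotomic_mul {q m : ℕ} (hq : q.Prime) (hm : 3 ≤ m)
    (h : 3 ≤ q ∧ q ∣ m ∨ 5 ≤ q) {z w : ℂ} (hz : ‖z‖ = Real.goldenRatio ^ 2)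
    (hzw : ‖z‖ * ‖w‖ = 1) :
    (q : ℝ) ^ 2 < ‖(cyclotomic (m * q) ℂ).eval z‖ * ‖(cyclotomic (m * q) ℂ).eval w‖ := by
  have hm0 : m ≠ 0 := by omega
  have hz1 : 2.6 < ‖z‖ := hz ▸ goldenRatio_sq_gt
  have hsum : ‖z‖ + ‖w‖ = 3 := by
    apply mul_left_cancel₀ (show ‖z‖ ≠ 0 by linarith)
    rw [mul_add, hzw, hz]
    linear_combination (Real.goldenRatio ^ 2 + Real.goldenRatio - 1) * Real.goldenRatio_sq
  have hw0 : 0 ≤ ‖w‖ := norm_nonneg w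
  have hw1 : ‖w‖ ≤ 1 := by nlinarith
  have hzq : 1 ≤ ‖z‖ ^ q := one_le_pow₀ (by linarith)
  have hwq : ‖w‖ ^ q ≤ 1 := pow_le_one₀ hw0 hw1
  have hwq0 : 0 ≤ ‖w‖ ^ q := pow_nonneg hw0 q
  have hzwq : ‖z‖ ^ q * ‖w‖ ^ q = 1 := by rw [← mul_pow, hzw, one_pow]
  set t := m.totient with ht
  have htpos : 2 ≤ t := by
    have := Nat.totient_even (n := m) (by omega)
    have := Nat.totient_pos.2 (show 0 < m by omega)
    rcases ‹Even _› with ⟨r, hr⟩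
    omega
  set A : ℝ := ‖z‖ ^ q - 2 with hA
  have hA0 : (q : ℝ) < A ∧ 0 < A := by
    have : (0 : ℝ) ≤ q := Nat.cast_nonneg q
    have := lt_goldenRatio_pow (q := q) (by omega)
    rw [hA, hz, ← pow_mul]
    constructor <;> linarith
  -- The factors multiply to `(‖z‖ ^ q - 1) * (1 - ‖w‖ ^ q) = ‖z‖ ^ q + ‖w‖ ^ q - 2 ≥ A`.
  have hlow : A ^ t ≤ ‖(cyclotomic m ℂ).eval (z ^ q)‖ * ‖(cyclotomic m ℂ).eval (w ^ q)‖ := by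
    have h1 := (norm_eval_cyclotomic_bounds m hm0 (z ^ q)).1
    have h2 := (norm_eval_cyclotomic_bounds m hm0 (w ^ q)).1
    rw [norm_pow] at h1 h2
    rw [abs_of_nonneg (by linarith)] at h1
    rw [abs_of_nonpos (by linarith)] at h2
    refine le_trans ?_ (mul_le_mul h1 h2 (pow_nonneg (by linarith) _) (norm_nonneg _))
    rw [← mul_pow]
    refine pow_le_pow_left₀ hA0.2.le ?_ t
    nlinarith
  have hexp : ∀ y : ℂ, (expand ℂ q (cyclotomic m ℂ)).eval y = (cyclotomic m ℂ).eval (y ^ q) :=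
    fun y => expand_eval q _ y
  have hq0 : (0 : ℝ) ≤ q := Nat.cast_nonneg q
  by_cases hdvd : q ∣ m
  · rw [← hexp, ← hexp, cyclotomic_expand_eq_cyclotomic hq hdvd] at hlow
    refine lt_of_lt_of_le ?_ hlow
    calc (q : ℝ) ^ 2 < A ^ 2 := pow_lt_pow_left₀ hA0.1 hq0 two_ne_zero
      _ ≤ A ^ t := pow_le_pow_right₀ (by
          have : (1 : ℝ) ≤ q := by exact_mod_cast hq.one_le
          linarith) htpos
  · have h5 : 5 ≤ q := by tauto
    rw [← hexp, ← hexp, cyclotomic_expand_eq_cyclotomic_mul hq hdvd, eval_mul, eval_mul,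
      norm_mul, norm_mul] at hlow
    -- Here `5 = (‖z‖ + 1) * (‖w‖ + 1)`, from product 1 and sum 3.
    have hup : ‖(cyclotomic m ℂ).eval z‖ * ‖(cyclotomic m ℂ).eval w‖ ≤ 5 ^ t := by
      have h1 := (norm_eval_cyclotomic_bounds m hm0 z).2
      have h2 := (norm_eval_cyclotomic_bounds m hm0 w).2
      refine (mul_le_mul h1 h2 (norm_nonneg _) (by positivity)).trans ?_
      rw [← mul_pow]
      exact pow_le_pow_left₀ (by positivity) (by linear_combination hzw + hsum) t
    set N := ‖(cyclotomic (m * q) ℂ).eval z‖ * ‖(cyclotomic (m * q) ℂ).eval w‖ with hN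
    have hN0 : 0 ≤ N := by positivity
    have h6 : A ^ t ≤ N * 5 ^ t := by
      refine (hlow.trans_eq ?_).trans (mul_le_mul_of_nonneg_left hup hN0)
      rw [hN]; ring
    have h7 : 5 * (q : ℝ) < A := by
      have := five_mul_lt_goldenRatio_pow h5
      rw [hA, hz, ← pow_mul]
      linarith
    have h8 : (A / 5) ^ t ≤ N := by
      rw [div_pow, div_le_iff₀ (by positivity)]
      exact h6
    have h9 : (q : ℝ) < A / 5 := by linarith
    refine lt_of_lt_of_le ?_ h8
    calc (q : ℝ) ^ 2 < (A / 5) ^ 2 := pow_lt_pow_left₀ h9 hq0 two_ne_zero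
      _ ≤ (A / 5) ^ t := pow_le_pow_right₀ (by
          have : (1 : ℝ) ≤ q := by exact_mod_cast hq.one_le
          linarith) htpos

/-! ### Norms of cyclotomic values in `ℤ[ω]`. -/

open scoped QuadraticAlgebra

/-- The value of the `m`-th cyclotomic polynomial at `-ω ^ 2`, where `ω ^ 2 = ω + 1`. -/
noncomputable def goldenCyclotomic (m : ℕ) : QuadraticAlgebra ℤ 1 1 :=
  (cyclotomic m (QuadraticAlgebra ℤ 1 1)).eval (-QuadraticAlgebra.omega ^ 2)

theorem omega_sq : (QuadraticAlgebra.omega : QuadraticAlgebra ℤ 1 1) ^ 2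
    = QuadraticAlgebra.omega + 1 := by
  ext <;> simp [pow_two]

theorem star_omega : star (QuadraticAlgebra.omega : QuadraticAlgebra ℤ 1 1)
    = 1 - QuadraticAlgebra.omega := by
  ext <;> simp

/-- The map `ω ↦ α` carries conjugation to `α ↦ 1 - α`. It is used over `ℂ` for size and in
characteristic `p` for prime factors. -/
theorem cast_norm_goldenCyclotomic (m : ℕ) {R : Type*} [CommRing R] {α : R}
    (h : α ^ 2 = α + 1) :
    (((goldenCyclotomic m).norm : ℤ) : R)
      = (cyclotomic m R).eval (-α ^ 2) * (cyclotomic m R).eval (-(1 - α) ^ 2) := by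
  let f : QuadraticAlgebra ℤ 1 1 →+* R :=
    (QuadraticAlgebra.lift ⟨α, by rw [← pow_two, h]; simp [add_comm]⟩ :
      QuadraticAlgebra ℤ 1 1 →ₐ[ℤ] R)
  have hf : f QuadraticAlgebra.omega = α := by simp [f]
  have h1 := congrArg f (QuadraticAlgebra.algebraMap_norm_eq_mul_star (goldenCyclotomic m))
  have h2 : f (goldenCyclotomic m) = (cyclotomic m R).eval (-α ^ 2) := by
    rw [goldenCyclotomic, ← hf, ← map_pow, ← map_neg, ← map_cyclotomic m f, eval_map_apply]
  have h3 : star (goldenCyclotomic m)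
      = (cyclotomic m _).eval (star (-QuadraticAlgebra.omega ^ 2)) := by
    have := eval_map_apply (f := starRingEnd (QuadraticAlgebra ℤ 1 1))
      (p := cyclotomic m (QuadraticAlgebra ℤ 1 1)) (-QuadraticAlgebra.omega ^ 2)
    rw [map_cyclotomic] at this
    exact this.symm
  have h4 : f (star (goldenCyclotomic m)) = (cyclotomic m R).eval (-(1 - α) ^ 2) := by
    rw [h3, star_neg, star_pow, star_omega, ← map_cyclotomic m f,
      show -(1 - α) ^ 2 = f (-(1 - QuadraticAlgebra.omega) ^ 2) by simp [hf], eval_map_apply]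
  rw [map_mul, h2, h4] at h1
  rw [← h1]
  simp

/-- Binet again: `1 - ω` is a unit and `2 * ω - 1` has norm `±5`. -/
theorem natAbs_norm_neg_omega_sq_pow_sub_one (k : ℕ) :
    ((-QuadraticAlgebra.omega ^ 2 : QuadraticAlgebra ℤ 1 1) ^ k - 1).norm.natAbs
      = 5 * Nat.fib k ^ 2 := by
  set w : QuadraticAlgebra ℤ 1 1 := QuadraticAlgebra.omega
  have h := fib_mul_two_mul_sub_one omega_sq k
  have h2 : (-w ^ 2) * (1 - w) = w := by linear_combination w * omega_sq
  have h3 : ((-w ^ 2) ^ k - 1) * (1 - w) ^ k = Nat.fib k * (2 * w - 1) := by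
    rw [h, sub_mul, ← mul_pow, h2, one_mul]
  have h4 := congrArg (fun z => (QuadraticAlgebra.norm z).natAbs) h3
  have h5 : (1 - w).norm.natAbs = 1 := by simp [w, QuadraticAlgebra.norm_def]
  have h6 : (2 * w - 1).norm.natAbs = 5 := by
    simp [w, QuadraticAlgebra.norm_def]
  simp only [map_mul, map_pow, Int.natAbs_mul, Int.natAbs_pow, h5, h6, one_pow, mul_one,
    QuadraticAlgebra.norm_natCast, Int.natAbs_natCast] at h4
  rw [h4, mul_comm]

theorem fib_sq_mul_natAbs_norm_dvd {d m : ℕ} (h : d ∈ m.properDivisors) :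
    Nat.fib d ^ 2 * (goldenCyclotomic m).norm.natAbs ∣ Nat.fib m ^ 2 := by
  have h1 := X_pow_sub_one_mul_cyclotomic_dvd_X_pow_sub_one_of_dvd (QuadraticAlgebra ℤ 1 1) h
  have h2 := map_dvd (evalRingHom (-QuadraticAlgebra.omega ^ 2)) h1
  simp only [map_mul, map_sub, map_pow, map_one, coe_evalRingHom, eval_X] at h2
  have h3 := Int.natAbs_dvd_natAbs.2 (map_dvd QuadraticAlgebra.norm h2)
  rw [map_mul, Int.natAbs_mul, natAbs_norm_neg_omega_sq_pow_sub_one,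
    natAbs_norm_neg_omega_sq_pow_sub_one, mul_assoc] at h3
  exact Nat.dvd_of_mul_dvd_mul_left (by norm_num) h3

theorem lt_natAbs_norm_goldenCyclotomic {q m : ℕ} (hq : q.Prime) (hm : 3 ≤ m)
    (h : 3 ≤ q ∧ q ∣ m ∨ 5 ≤ q) : q ^ 2 < (goldenCyclotomic (m * q)).norm.natAbs := by
  have hα : (Real.goldenRatio : ℂ) ^ 2 = Real.goldenRatio + 1 := by
    exact_mod_cast congrArg (Complex.ofReal) Real.goldenRatio_sq
  have h1 := congrArg norm (cast_norm_goldenCyclotomic (m * q) hα)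
  have hz : ‖-(Real.goldenRatio : ℂ) ^ 2‖ = Real.goldenRatio ^ 2 := by
    rw [norm_neg, norm_pow, Complex.norm_real, Real.norm_eq_abs, sq_abs]
  have hzw : ‖-(Real.goldenRatio : ℂ) ^ 2‖ * ‖-(1 - (Real.goldenRatio : ℂ)) ^ 2‖ = 1 := by
    rw [← norm_mul, show -(Real.goldenRatio : ℂ) ^ 2 * -(1 - (Real.goldenRatio : ℂ)) ^ 2
      = (Real.goldenRatio * (1 - Real.goldenRatio)) ^ 2 by ring,
      show (Real.goldenRatio : ℂ) * (1 - Real.goldenRatio) = -1 by linear_combination -hα]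
    simp
  have h2 := lt_norm_eval_cyclotomic_mul hq hm h hz hzw
  rw [← norm_mul, ← h1, Complex.norm_intCast, ← Int.cast_abs, Int.abs_eq_natAbs] at h2
  exact_mod_cast h2

theorem exists_sq_eq_add_one (K : Type*) [Field K] [IsAlgClosed K] : ∃ α : K, α ^ 2 = α + 1 := by
  obtain ⟨α, hα⟩ := IsAlgClosed.exists_root (X ^ 2 - X - 1 : K[X]) (by
    have : (X ^ 2 - X - 1 : K[X]).degree = 2 := by compute_degree!
    rw [this]; norm_num)
  refine ⟨α, ?_⟩
  simp only [IsRoot, eval_sub, eval_pow, eval_X, eval_one] at hα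
  linear_combination hα

/-- A prime dividing the norm of the `m`-th cyclotomic value has rank of apparition `r`, where
`m` is `r` times a power of that prime. -/
theorem exists_rank_of_dvd_norm {p m : ℕ} (hp : p.Prime) (hm : m ≠ 0)
    (h : p ∣ (goldenCyclotomic m).norm.natAbs) :
    ∃ j r, m = p ^ j * r ∧ ¬ p ∣ r ∧ (r ∣ p - 1 ∨ r ∣ p + 1) ∧ (p = 5 → r = 1) ∧
      (p ≠ 5 → ∀ k, p ∣ Nat.fib k ↔ r ∣ k) := by
  have : Fact p.Prime := ⟨hp⟩
  let K := AlgebraicClosure (ZMod p)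
  have : CharP K p := charP_of_injective_algebraMap (algebraMap (ZMod p) K).injective p
  obtain ⟨α, hα⟩ := exists_sq_eq_add_one K
  obtain ⟨j, r, hpr, hmr⟩ := Nat.exists_eq_pow_mul_and_not_dvd hm p hp.ne_one
  have : NeZero (r : K) := ⟨by rwa [Ne, CharP.cast_eq_zero_iff K p]⟩
  obtain ⟨β, hβ, hr⟩ : ∃ β : K, β ^ 2 = β + 1 ∧ IsPrimitiveRoot (-β ^ 2) r := by
    have h1 := cast_norm_goldenCyclotomic m hα
    have h2 : (((goldenCyclotomic m).norm : ℤ) : K) = 0 := by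
      rw [CharP.intCast_eq_zero_iff K p, Int.natCast_dvd]
      exact h
    rw [h2, eq_comm, hmr] at h1
    rcases mul_eq_zero.1 h1 with h3 | h3
    · exact ⟨α, hα, isRoot_cyclotomic_prime_pow_mul_iff_of_charP.1 h3⟩
    · exact ⟨1 - α, by linear_combination hα, isRoot_cyclotomic_prime_pow_mul_iff_of_charP.1 h3⟩
  have hfive : (5 : K) = 0 ↔ p = 5 := by
    rw [show (5 : K) = ((5 : ℕ) : K) by norm_num, CharP.cast_eq_zero_iff K p,
      Nat.prime_dvd_prime_iff_eq hp Nat.prime_five]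
  refine ⟨j, r, hmr, hpr, ?_, ?_, ?_⟩
  · rw [← hr.pow_eq_one_iff_dvd, ← hr.pow_eq_one_iff_dvd]
    exact neg_sq_pow_sub_one_or_add_one hβ
  · intro h5
    rw [neg_sq_eq_one_of_five_eq_zero hβ (hfive.2 h5)] at hr
    exact hr.unique IsPrimitiveRoot.one
  · intro h5 k
    rw [← hr.pow_eq_one_iff_dvd, neg_sq_pow_eq_one_iff hβ (mt hfive.1 h5),
      CharP.cast_eq_zero_iff K p]

/-! ### Primes of rank exactly `m`. -/

/-- For a prime `m` other than `5`, every prime factor of `F m` has rank `m`. -/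
theorem rank_of_prime {p m : ℕ} (hp : p.Prime) (hm : m.Prime) (hm5 : m ≠ 5)
    (h : p ∣ Nat.fib m) :
    (∀ k, p ∣ Nat.fib k ↔ m ∣ k) ∧ (m ∣ p - 1 ∨ m ∣ p + 1) := by
  have hrank : ∀ k, p ∣ Nat.fib k ↔ m ∣ k := by
    intro k
    refine ⟨fun hk => ?_, fun hk => h.trans (Nat.fib_dvd _ _ hk)⟩
    by_contra hmk
    have := Nat.dvd_gcd h hk
    rw [← Nat.fib_gcd, (Nat.Coprime.gcd_eq_one ((Nat.Prime.coprime_iff_not_dvd hm).2 hmk)),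
      Nat.fib_one] at this
    exact hp.one_lt.ne' (Nat.dvd_one.1 this)
  refine ⟨hrank, ?_⟩
  have hp5 : p ≠ 5 := by
    rintro rfl
    have := (hrank 5).1 (by decide)
    exact hm5 ((Nat.prime_dvd_prime_iff_eq hm Nat.prime_five).1 this)
  have : Fact p.Prime := ⟨hp⟩
  let K := AlgebraicClosure (ZMod p)
  have : CharP K p := charP_of_injective_algebraMap (algebraMap (ZMod p) K).injective p
  obtain ⟨α, hα⟩ := exists_sq_eq_add_one K
  have hfive : (5 : K) ≠ 0 := by
    rw [show (5 : K) = ((5 : ℕ) : K) by norm_num, Ne, CharP.cast_eq_zero_iff K p,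
      Nat.prime_dvd_prime_iff_eq hp Nat.prime_five]
    exact hp5
  rw [← hrank, ← hrank, ← CharP.cast_eq_zero_iff K p, ← CharP.cast_eq_zero_iff K p,
    ← neg_sq_pow_eq_one_iff hα hfive, ← neg_sq_pow_eq_one_iff hα hfive]
  exact neg_sq_pow_sub_one_or_add_one hα

theorem exists_primitive_prime_of_not_prime {m : ℕ} (hm : 1 < m) (hodd : Odd m)
    (hnp : ¬ m.Prime) :
    ∃ p : ℕ, p.Prime ∧ (∀ k, p ∣ Nat.fib k ↔ m ∣ k) ∧ (m ∣ p - 1 ∨ m ∣ p + 1) := by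
  by_contra hcon
  have hm0 : m ≠ 0 := by omega
  set N := (goldenCyclotomic m).norm.natAbs with hN
  -- every prime factor of `N` divides `m`
  have key : ∀ p : ℕ, p.Prime → p ∣ N →
      ∃ j r, m = p ^ (j + 1) * r ∧ r < p ∧ 3 ≤ p ∧ (p = 5 → r = 1) ∧
        (p ≠ 5 → ∀ k, p ∣ Nat.fib k ↔ r ∣ k) := by
    intro p hp hpN
    obtain ⟨j, r, h1, h2, h3, h4, h5⟩ := exists_rank_of_dvd_norm hp hm0 hpN
    cases j with
    | zero =>
      rw [pow_zero, one_mul] at h1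
      subst h1
      have hp5 : p ≠ 5 := fun h => hm.ne' (h4 h)
      exact absurd ⟨p, hp, h5 hp5, h3⟩ hcon
    | succ j =>
      rw [h1] at hodd
      have hpo : Odd p := (Nat.odd_pow_iff (by omega)).1 (Nat.odd_mul.1 hodd).1
      have hro : Odd r := (Nat.odd_mul.1 hodd).2
      have hp3 : 3 ≤ p := by
        have := hp.two_le
        rcases hpo with ⟨t, ht⟩
        omega
      refine ⟨j, r, h1, ?_, hp3, h4, h5⟩
      have h2r : Nat.Coprime r 2 := Nat.coprime_two_right.2 hro
      obtain ⟨t, ht⟩ := hpo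
      rcases h3 with h | h
      · rw [show p - 1 = t * 2 by omega] at h
        have := Nat.le_of_dvd (by omega) (h2r.dvd_of_dvd_mul_right h)
        omega
      · rw [show p + 1 = (t + 1) * 2 by omega] at h
        have := Nat.le_of_dvd (by omega) (h2r.dvd_of_dvd_mul_right h)
        omega
  have ge_three : ∀ {s p : ℕ}, m = s * p → p.Prime → 3 ≤ s := by
    intro s p h hp
    have hs : Odd s := by rw [h] at hodd; exact (Nat.odd_mul.1 hodd).1
    have hs1 : s ≠ 1 := by
      rintro rfl
      exact hnp (by rwa [h, one_mul])
    obtain ⟨t, ht⟩ := hs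
    omega
  have bound : ∀ {p s : ℕ}, p.Prime → m = s * p → (3 ≤ p ∧ p ∣ s ∨ 5 ≤ p) → p ^ 2 < N := by
    intro p s hp h1 h
    rw [hN, h1]
    exact lt_natAbs_norm_goldenCyclotomic hp (ge_three h1 hp) h
  have hN1 : N ≠ 1 := by
    have hp := Nat.minFac_prime hm.ne'
    obtain ⟨s, hs⟩ := m.minFac_dvd
    have hp3 : 3 ≤ m.minFac := by
      have hpo : Odd m.minFac := hodd.of_dvd_nat m.minFac_dvd
      have := hp.two_le
      obtain ⟨t, ht⟩ := hpo
      omega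
    have hs3 := ge_three (hs.trans (mul_comm _ _)) hp
    have hq := Nat.minFac_prime (n := s) (by omega)
    have hqm : s.minFac ∣ m := by
      rw [hs]; exact Dvd.dvd.mul_left s.minFac_dvd _
    have hle := Nat.minFac_le_of_dvd hq.two_le hqm
    suffices ∃ p, p.Prime ∧ p ^ 2 < N by
      obtain ⟨p, hp, h⟩ := this
      have := pow_pos hp.pos 2
      omega
    -- Either the least prime of `m` is repeated, or the next prime factor is at least 5.
    rcases hle.eq_or_lt with h | h
    · exact ⟨_, hp, bound hp (hs.trans (mul_comm _ _)) (Or.inl ⟨hp3, h ▸ s.minFac_dvd⟩)⟩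
    · obtain ⟨t, ht⟩ := hqm
      obtain ⟨u, hu⟩ := hodd.of_dvd_nat (Dvd.intro t ht.symm)
      exact ⟨_, hq, bound hq (ht.trans (mul_comm _ _)) (Or.inr (by omega))⟩
  obtain ⟨p, hp, hpN⟩ := Nat.exists_prime_and_dvd hN1
  obtain ⟨j, r, h1, hr, hp3, h5, hrank⟩ := key p hp hpN
  have hb : p ^ 2 < N := by
    have h2 : m = p ^ j * r * p := by rw [h1]; ring
    refine bound hp h2 ?_
    cases j with
    | zero =>
      have := ge_three h2 hp
      rw [pow_zero, one_mul] at this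
      obtain ⟨t, ht⟩ := hp.odd_of_ne_two (by omega)
      right
      omega
    | succ j => exact Or.inl ⟨hp3, Dvd.dvd.mul_right (dvd_pow_self p j.succ_ne_zero) r⟩
  have huniq : ∀ {q : ℕ}, q.Prime → q ∣ N → q = p := by
    intro q hq hqN
    -- Distinct `p` and `q` would give `q ≤ r < p` and `p ≤ r' < q`.
    obtain ⟨j', r', h1', hr', -, -, -⟩ := key q hq hqN
    by_contra hne
    have hqr : q ∣ r := by
      have : q ∣ p ^ (j + 1) * r := by rw [← h1, h1', pow_succ', mul_assoc]; exact dvd_mul_right _ _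
      exact (Nat.Coprime.dvd_of_dvd_mul_left
        (Nat.Coprime.pow_right _ ((Nat.coprime_primes hq hp).2 hne)) this)
    have hpr : p ∣ r' := by
      have : p ∣ q ^ (j' + 1) * r' := by rw [← h1', h1, pow_succ', mul_assoc]; exact dvd_mul_right _ _
      exact (Nat.Coprime.dvd_of_dvd_mul_left
        (Nat.Coprime.pow_right _ ((Nat.coprime_primes hp hq).2 (Ne.symm hne))) this)
    have hr0 : r ≠ 0 := by rintro rfl; simp [h1] at hm0
    have hr0' : r' ≠ 0 := by rintro rfl; simp [h1'] at hm0
    have := Nat.le_of_dvd (Nat.pos_of_ne_zero hr0) hqr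
    have := Nat.le_of_dvd (Nat.pos_of_ne_zero hr0') hpr
    omega
  have hNpow := Nat.eq_prime_pow_of_unique_prime_dvd (n := N) (p := p) (by omega) huniq
  set a := p ^ j * r with ha
  have hma : m = a * p := by rw [h1, ha]; ring
  have ha0 : 0 < a := Nat.pos_of_ne_zero (by rintro h0; rw [hma, h0, zero_mul] at hm0; exact hm0 rfl)
  have hpa : p ∣ Nat.fib a := by
    by_cases hp5 : p = 5
    · have hr1 := h5 hp5
      have hj : j ≠ 0 := by
        rintro rfl
        rw [hr1] at h1
        exact hnp (by simpa [h1] using hp)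
      have h5a : 5 ∣ a := by
        rw [ha, hp5]; exact Dvd.dvd.mul_right (dvd_pow_self 5 hj) r
      rw [hp5]
      exact Nat.fib_dvd 5 a h5a
    · exact (hrank hp5 a).2 (dvd_mul_left _ _)
  obtain ⟨Q, hQ⟩ := Nat.fib_dvd a (a * p) (dvd_mul_right _ _)
  have hnsq := not_sq_dvd_of_fib_mul_eq hp (hp.odd_of_ne_two (by omega)) ha0 hpa hQ
  have hdvd : N ∣ Q ^ 2 := by
    have := fib_sq_mul_natAbs_norm_dvd (d := a) (m := m) (by
      rw [Nat.mem_properDivisors, hma]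
      refine ⟨dvd_mul_right _ _, ?_⟩
      nlinarith)
    rw [← hN, hma, hQ, mul_pow] at this
    exact Nat.dvd_of_mul_dvd_mul_left (pow_pos (Nat.fib_pos.2 ha0) 2) this
  set e := N.primeFactorsList.length
  rw [hNpow] at hdvd hb
  have he : 2 < e := (Nat.pow_lt_pow_iff_right hp.one_lt).1 hb
  have h3 : p ^ 3 ∣ Q ^ 2 := (pow_dvd_pow p he).trans hdvd
  have hpQ : p ∣ Q := hp.dvd_of_dvd_pow ((dvd_pow_self p (by norm_num)).trans h3)
  obtain ⟨s, rfl⟩ := hpQ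
  rw [mul_pow, pow_succ p 2] at h3
  have hps := hp.dvd_of_dvd_pow (Nat.dvd_of_mul_dvd_mul_left (pow_pos hp.pos 2) h3)
  exact hnsq (by rw [pow_two]; exact mul_dvd_mul_left p hps)

/-- Carmichael's theorem for odd indices: `F m` has a prime factor of rank `m`. -/
theorem exists_primitive_prime {m : ℕ} (hm : 1 < m) (hodd : Odd m) (hm5 : m ≠ 5) :
    ∃ p : ℕ, p.Prime ∧ (∀ k, p ∣ Nat.fib k ↔ m ∣ k) ∧ (m ∣ p - 1 ∨ m ∣ p + 1) := by
  by_cases hmp : m.Prime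
  · have h3 : 3 ≤ m := by rcases hodd with ⟨t, ht⟩; omega
    have : Nat.fib m ≠ 1 := by
      have := Nat.fib_mono h3
      have : Nat.fib 3 = 2 := rfl
      omega
    obtain ⟨p, hp, hpm⟩ := Nat.exists_prime_and_dvd this
    exact ⟨p, hp, rank_of_prime hp hmp hm5 hpm⟩
  · exact exists_primitive_prime_of_not_prime hm hodd hmp

/-! ### The sum for prime and for composite `n`. -/

theorem fib_dvd_sum_of_prime {n : ℕ} (hn : n.Prime) :
    Nat.fib n ∣ ∑ k ∈ Finset.Icc 1 (n - 1), Nat.fib (k * n) / Nat.fib k := by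
  refine Finset.dvd_sum fun k hk => ?_
  rw [Finset.mem_Icc] at hk
  have hco : Nat.Coprime (Nat.fib n) (Nat.fib k) := by
    rw [Nat.Coprime, ← Nat.fib_gcd, Nat.Coprime.gcd_eq_one, Nat.fib_one]
    exact (Nat.coprime_of_lt_prime (by omega) (by have := hn.two_le; omega) hn)
  refine hco.dvd_of_dvd_mul_right ?_
  rw [Nat.div_mul_cancel (Nat.fib_dvd k (k * n) (Dvd.intro n rfl))]
  exact Nat.fib_dvd n _ (Dvd.intro_left k rfl)

/-- If the prime `q` has rank `m` and `m ∣ n`, the sum is `(n / m - 1) * n` modulo `q`. -/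
theorem sum_fib_mul_div_modEq {n m p q : ℕ} (hn : n = m * p) (hm : 0 < m) (hp : 0 < p)
    (hmod : n ≡ 1 [MOD 4]) (hq : q.Prime) (hrank : ∀ k, q ∣ Nat.fib k ↔ m ∣ k) :
    ∑ k ∈ Finset.Icc 1 (n - 1), Nat.fib (k * n) / Nat.fib k ≡ (p - 1) * n [MOD q] := by
  have hterm : ∀ k ∈ Finset.Icc 1 (n - 1), Nat.fib (k * n) / Nat.fib k
      ≡ (if m ∣ k then n else 0) [MOD q] := by
    intro k hk
    rw [Finset.mem_Icc] at hk
    split_ifs with hmk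
    · exact (fib_mul_div_modEq_of_modEq_one hmod hk.1).of_dvd ((hrank k).2 hmk)
    · rw [Nat.modEq_zero_iff_dvd]
      have h1 : q ∣ Nat.fib (k * n) := (hrank _).2 (Dvd.dvd.mul_left (Dvd.intro p hn.symm) k)
      rw [← Nat.div_mul_cancel (Nat.fib_dvd k (k * n) (Dvd.intro n rfl))] at h1
      exact (hq.dvd_mul.1 h1).resolve_right fun h => hmk ((hrank k).1 h)
  have hsum := Nat.ModEq.sum hterm
  rw [← Finset.sum_filter, Finset.sum_const, smul_eq_mul] at hsum
  have hcard : (Finset.filter (fun k => m ∣ k) (Finset.Icc 1 (n - 1))).card = p - 1 := by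
    have := Nat.Ioc_filter_dvd_card_eq_div (n - 1) m
    rw [show Finset.Icc 1 (n - 1) = Finset.Ioc 0 (n - 1) from rfl, this, hn]
    obtain ⟨p, rfl⟩ := Nat.exists_eq_add_of_lt hp
    have h : m * (0 + p + 1) = p * m + m := by ring
    rw [h, show 0 + p + 1 - 1 = p by omega]
    refine Nat.div_eq_of_lt_le (by omega) ?_
    rw [add_mul]
    omega
  rwa [hcard] at hsum

theorem mainTheorem3 (n : ℕ) (hn : 1 < n) (hmod : n ≡ 1 [MOD 4]) (h9 : n ≠ 9) (h25 : n ≠ 25) :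
    (∑ k ∈ Finset.Icc 1 (n - 1), Nat.fib (k * n) / Nat.fib k) ≡ 0 [MOD Nat.fib n] ↔
      n.Prime := by
  refine ⟨fun h => ?_, fun h => (Nat.modEq_zero_iff_dvd).2 (fib_dvd_sum_of_prime h)⟩
  by_contra hnp
  have h4 : n % 4 = 1 := hmod
  set p := n.minFac with hpdef
  have hp : p.Prime := Nat.minFac_prime (by omega)
  obtain ⟨m, hm⟩ := n.minFac_dvd
  rw [← hpdef] at hm
  have hodd : Odd n := Nat.odd_iff.2 (by omega)
  have hmo : Odd m := by rw [hm] at hodd; exact (Nat.odd_mul.1 hodd).2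
  have hpo : Odd p := by rw [hm] at hodd; exact (Nat.odd_mul.1 hodd).1
  have hm1 : m ≠ 1 := by rintro rfl; exact hnp (by rw [hm, mul_one]; exact hp)
  have hm3 : 3 ≤ m := by rcases hmo with ⟨t, ht⟩; omega
  have hp3 : 3 ≤ p := by have := hp.two_le; rcases hpo with ⟨t, ht⟩; omega
  have hpm : p ≤ m := by
    have h1 := Nat.minFac_le_of_dvd (n := n) (m := m) (by omega) (hm ▸ dvd_mul_left _ _)
    omega
  -- With `m = 5`, `p` is 3 or 5: 15 is 3 modulo 4, and 25 is excluded.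
  have hm5 : m ≠ 5 := by
    rintro rfl
    rcases hpo with ⟨t, ht⟩
    interval_cases p <;> omega
  obtain ⟨q, hq, hrank, hqm⟩ := exists_primitive_prime (by omega) hmo hm5
  have h1 := sum_fib_mul_div_modEq (hm.trans (mul_comm _ _)) (by omega) hp.pos hmod hq hrank
  have hqn : q ∣ Nat.fib n := (hrank n).2 (hm ▸ dvd_mul_left _ _)
  have h2 : q ∣ (p - 1) * n := Nat.modEq_zero_iff_dvd.1 (h1.symm.trans (h.of_dvd hqn))
  have hqle : q ≤ m := by
    rcases hq.dvd_mul.1 h2 with h3 | h3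
    · have := Nat.le_of_dvd (by omega) h3; omega
    · rw [hm] at h3
      rcases hq.dvd_mul.1 h3 with h4 | h4
      · have := Nat.le_of_dvd (by omega) h4; omega
      · exact Nat.le_of_dvd (by omega) h4
  rcases hq.eq_two_or_odd' with rfl | hqo
  · have hm' : m = 3 := by
      rcases hqm with h3 | h3 <;> have := Nat.le_of_dvd (by norm_num) h3 <;> omega
    have : p = 3 := by omega
    rw [this, hm'] at hm
    exact h9 hm
  -- Both `q - 1` and `q + 1` are even, so the odd `m` divides half of one of them and is less than
  -- `q`.
  · have hc : Nat.Coprime m 2 := Nat.coprime_two_right.2 hmo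
    obtain ⟨t, ht⟩ := hqo
    have := hq.two_le
    rcases hqm with h3 | h3
    · rw [show q - 1 = t * 2 by omega] at h3
      have := Nat.le_of_dvd (by omega) (hc.dvd_of_dvd_mul_right h3)
      omega
    · rw [show q + 1 = (t + 1) * 2 by omega] at h3
      have := Nat.le_of_dvd (by omega) (hc.dvd_of_dvd_mul_right h3)
      omega
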